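/- Let $N$ be a prime number greater than $3$ and let $m$ be the (unique, non-zero) integer with $N=|6m-1|$. Write $(q)_\infty=\prod_{k\ge 1}(1-q^k)$, and let $J_0(q),\dots,J_{N-1}(q)$ be the (unique) power series in $q$ with integer exponents and integer coefficients such that $$\frac{(q^{1/N})_\infty}{(q^N)_\infty}=J_0(q)+q^{1/N}J_1(q)+q^{2/N}J_2(q)+\cdots+q^{(N-1)/N}J_{N-1}(q).$$ Let $S\subseteq\{0,1,\dots,N-1\}$ be the set of the indices $p$ with $J_p\neq 0$. Then $S$ has exactly $(N+1)/2$ elements, the number $$Z=\frac{(N-1)(N+1)^2}{48N}-\sum_{p\in S}\frac{p}{N}$$ is a non-negative integer, and $$\prod_{p\in S}J_p(q)=(-1)^{|m|(|m|-1)/2}\,q^{Z}.$$ -/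

import Mathlib

namespace RamanujanJ

open PowerSeries
open scoped PowerSeries.WithPiTopology

/-- The Euler function `(a)_∞ = ∏_{k ≥ 1} (1 - a ^ k)`, for a formal power series `a` with integer
coefficients. The product is taken in the topology of coefficientwise convergence
(`ℤ` being discrete). -/
noncomputable def euler (a : ℤ⟦X⟧) : ℤ⟦X⟧ := ∏' k : ℕ, (1 - a ^ (k + 1))

/-- The quotient `(q^{1/N})_∞ / (q^N)_∞`, as a formal power series in the variable `X = q^{1/N}`,
so that `q = X ^ N` and `q ^ N = X ^ (N ^ 2)`. -/
noncomputable def eulerQuotient (N : ℕ) : ℤ⟦X⟧ :=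
  euler X * invOfUnit (euler (X ^ N ^ 2)) 1

/-- The function `J_p(q)`, a power series in `X = q` with integer coefficients: the coefficient of
`q ^ n` in `J_p` is the coefficient of `q ^ (p / N) * q ^ n = (q^{1/N}) ^ (N * n + p)` in
`(q^{1/N})_∞ / (q^N)_∞`. -/
noncomputable def J (N p : ℕ) : ℤ⟦X⟧ :=
  PowerSeries.mk fun n => coeff (N * n + p) (eulerQuotient N)

open Classical in
/-- The set `S` of the indices `p ∈ {0, …, N - 1}` with `J_p ≠ 0`. -/
noncomputable def nonzeroIndices (N : ℕ) : Finset ℕ :=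
  (Finset.range N).filter fun p => J N p ≠ 0

/-- The infinite product that defines `(X ^ d)_∞` converges. -/
theorem multipliable_euler {d : ℕ} (hd : d ≠ 0) :
    Multipliable fun k : ℕ => (1 : ℤ⟦X⟧) - (X ^ d) ^ (k + 1) := by
  simp_rw [sub_eq_add_neg]
  apply WithPiTopology.multipliable_one_add_of_tendsto_order_atTop_nhds_top
  refine ENat.tendsto_nhds_top_iff_natCast_lt.mpr fun n =>
    Filter.eventually_atTop.mpr ⟨n, fun m hm => ?_⟩
  rw [order_neg, ← pow_mul, order_X_pow]
  norm_cast
  nlinarith [Nat.one_le_iff_ne_zero.mpr hd]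

/-- `(X ^ d)_∞` has constant coefficient `1`; hence it is invertible. -/
theorem constantCoeff_euler {d : ℕ} (hd : d ≠ 0) :
    constantCoeff (euler ((X : ℤ⟦X⟧) ^ d)) = 1 := by
  rw [euler, (multipliable_euler hd).map_tprod _
    (WithPiTopology.continuous_constantCoeff ℤ)]
  simp [hd]

/-- `eulerQuotient N` is the quotient of `(q^{1/N})_∞` by `(q^N)_∞`. -/
theorem euler_mul_eulerQuotient {N : ℕ} (hN : N ≠ 0) :
    euler (X ^ N ^ 2) * eulerQuotient N = euler X := by
  have h := mul_invOfUnit (euler ((X : ℤ⟦X⟧) ^ N ^ 2)) 1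
    (by simpa using constantCoeff_euler (pow_ne_zero 2 hN))
  rw [eulerQuotient, mul_left_comm, h, mul_one]

/-- Power series `K_0, …, K_{N-1}` satisfy
`(q^{1/N})_∞ / (q^N)_∞ = ∑_{p < N} q^{p/N} K_p(q)` if and only if they are `J_0, …, J_{N-1}`. -/
theorem expansion_iff {N : ℕ} (hN : N ≠ 0) (K : ℕ → ℤ⟦X⟧) :
    eulerQuotient N = ∑ p ∈ Finset.range N, X ^ p * expand N hN (K p) ↔
      ∀ p < N, K p = J N p := by
  have key : ∀ p < N, ∀ n, coeff (N * n + p)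
      (∑ r ∈ Finset.range N, X ^ r * expand N hN (K r)) = coeff n (K p) := by
    intro p hp n
    rw [map_sum, Finset.sum_eq_single p]
    · rw [add_comm, coeff_X_pow_mul', if_pos (by omega), Nat.add_sub_cancel_left, coeff_expand_mul]
    · intro r hr hrp
      rw [coeff_X_pow_mul']
      split_ifs with h
      · rw [coeff_expand_of_not_dvd]
        rintro ⟨c, hc⟩
        have hr' := Finset.mem_range.mp hr
        have h1 : N * n + p = N * c + r := by omega
        have h2 := congrArg (· % N) h1
        simp only [Nat.mul_add_mod, Nat.mod_eq_of_lt hp, Nat.mod_eq_of_lt hr'] at h2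
        exact hrp h2.symm
      · rfl
    · intro h
      exact absurd (Finset.mem_range.mpr hp) h
  constructor
  · intro h p hp
    ext n
    rw [J, coeff_mk, h, key p hp]
  · intro h
    ext n
    have hp : n % N < N := Nat.mod_lt _ (Nat.pos_of_ne_zero hN)
    have h1 := key (n % N) hp (n / N)
    rw [Nat.div_add_mod] at h1
    rw [h1, h _ hp, J, coeff_mk, Nat.div_add_mod]

end RamanujanJ

namespace RamanujanJ

open PowerSeries Filter Topology
open scoped PowerSeries.WithPiTopology

/-! By the pentagonal number theorem and `24 * pentagonal k + 1 = (6k - 1)^2`, the terms of `(X)_∞`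
with exponents in one class mod `N` form, after `X ↦ X^24` and a shift, theta series over `k ≡ m ±
r` mod `N` (`etaPart_pentagonal`), because `N ∣ 6m - 1`.

Write `N = 2h + 1`, `T s = theta 3 (N - 2s) (2N)` and `θ = theta 1 N (6N)`. The quintuple product
identity (`theta_quintuple`) says that the part of index `r = s ≠ 0` is `± θ * T (2s) / T s`; for `r
= 0` it is `± θ`. Doubling permutes `{1, …, h}` up to sign mod `N` and `T` respects that sign, so
the `T` factors cancel in the product over `s ≤ h`, leaving `± θ^(h+1)` (`prod_etaPart`). As `θ` is
a shifted and rescaled `(q^N)_∞`, dividing by it leaves a signed monomial (`prod_J_expand`). This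
nonzero product also shows that no factor vanishes, which determines `S`. -/

/-! ### Theta series and their products -/

theorem summable_monomial {ι : Type*} {f : ι → ℕ} (c : ι → ℤ) (hf : ∀ n, (f ⁻¹' {n}).Finite) :
    Summable fun i => monomial (f i) (c i) := by
  rw [WithPiTopology.summable_iff_summable_coeff]
  intro n
  refine summable_of_hasFiniteSupport ((hf n).subset fun i hi => ?_)
  by_contra h
  exact hi ((coeff_monomial ..).trans (if_neg fun h' => h h'.symm))

theorem finite_fiber_add {ι κ : Type*} {f : ι → ℕ} {g : κ → ℕ} (hf : ∀ n, (f ⁻¹' {n}).Finite)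
    (hg : ∀ n, (g ⁻¹' {n}).Finite) (n : ℕ) :
    ((fun x : ι × κ => f x.1 + g x.2) ⁻¹' {n}).Finite := by
  refine (((Set.finite_Iic n).biUnion fun a _ => hf a).prod
    ((Set.finite_Iic n).biUnion fun a _ => hg a)).subset fun x hx => ?_
  simp only [Set.mem_preimage, Set.mem_singleton_iff] at hx
  simp only [Set.mem_prod, Set.mem_iUnion, Set.mem_Iic, Set.mem_preimage, Set.mem_singleton_iff,
    exists_prop, exists_eq_right']
  omega

/-- The term `(-1) ^ j * X ^ (e * (a + d * j) ^ 2)` of a theta series. -/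
noncomputable def thetaTerm (e : ℕ) (a d j : ℤ) : ℤ⟦X⟧ :=
  monomial (e * (a + d * j).natAbs ^ 2) (j.negOnePow : ℤ)

/-- The theta series `∑_j (-1) ^ j * X ^ (e * (a + d * j) ^ 2)`. -/
noncomputable def theta (e : ℕ) (a d : ℤ) : ℤ⟦X⟧ := ∑' j, thetaTerm e a d j

theorem finite_fiber_square {e : ℕ} (he : e ≠ 0) (a : ℤ) {d : ℤ} (hd : d ≠ 0) (n : ℕ) :
    ((fun j : ℤ => e * (a + d * j).natAbs ^ 2) ⁻¹' {n}).Finite := by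
  have hinj : Function.Injective fun j : ℤ => a + d * j := fun x y h => by
    simpa [hd] using h
  refine ((Set.finite_Icc (-(n : ℤ)) n).preimage hinj.injOn).subset fun j hj => ?_
  simp only [Set.mem_preimage, Set.mem_singleton_iff] at hj
  simp only [Set.mem_preimage, Set.mem_Icc]
  have h1 : (a + d * j).natAbs ≤ n := by
    rw [← hj]
    calc (a + d * j).natAbs ≤ (a + d * j).natAbs ^ 2 := Nat.le_self_pow two_ne_zero _
      _ ≤ e * (a + d * j).natAbs ^ 2 := Nat.le_mul_of_pos_left _ (Nat.pos_of_ne_zero he)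
  omega

theorem hasSum_theta {e : ℕ} (he : e ≠ 0) (a : ℤ) {d : ℤ} (hd : d ≠ 0) :
    HasSum (thetaTerm e a d) (theta e a d) :=
  (summable_monomial _ (finite_fiber_square he a hd)).hasSum

theorem hasSum_theta_mul {e e' : ℕ} (he : e ≠ 0) (he' : e' ≠ 0) (a a' : ℤ) {d d' : ℤ}
    (hd : d ≠ 0) (hd' : d' ≠ 0) :
    HasSum (fun x : ℤ × ℤ => thetaTerm e a d x.1 * thetaTerm e' a' d' x.2)
      (theta e a d * theta e' a' d') := by
  refine (hasSum_theta he a hd).mul (hasSum_theta he' a' hd') ?_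
  simp only [thetaTerm, monomial_mul_monomial]
  exact summable_monomial _
    (finite_fiber_add (finite_fiber_square he a hd) (finite_fiber_square he' a' hd'))

theorem theta_neg {e : ℕ} (he : e ≠ 0) (a : ℤ) {d : ℤ} (hd : d ≠ 0) :
    theta e (-a) d = theta e a d := by
  have h := hasSum_theta he a hd
  rw [← (Equiv.neg ℤ).hasSum_iff] at h
  refine (hasSum_theta he (-a) hd).unique ?_
  convert h using 1
  ext1 j
  simp only [thetaTerm, Function.comp_apply, Equiv.neg_apply, Int.negOnePow_neg]
  rw [show a + d * -j = -(-a + d * j) by ring, Int.natAbs_neg]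

/-! ### The quintuple product identity -/

/-- Pairs of integers, split according to the parity of their sum. -/
def paritySplit : (ℤ × ℤ) ⊕ (ℤ × ℤ) ≃ ℤ × ℤ where
  toFun := Sum.elim (fun x => (x.1, 2 * x.2 - x.1)) fun x => (x.1, 2 * x.2 + 1 - x.1)
  invFun y := if Even (y.1 + y.2) then .inl (y.1, (y.1 + y.2) / 2) else .inr (y.1, (y.1 + y.2) / 2)
  left_inv x := by
    rcases x with ⟨a, b⟩ | ⟨a, b⟩
    · simp
    · have h : ¬ Even (2 * b + 1) := by simp
      simp only [Sum.elim_inr, add_sub_cancel, h, if_false, Sum.inr.injEq, Prod.mk.injEq, true_and]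
      omega
  right_inv y := by
    rcases y with ⟨a, b⟩
    by_cases h : Even (a + b)
    · simp only [h, if_true, Sum.elim_inl, Prod.mk.injEq, true_and]
      rw [Int.even_iff] at h; omega
    · simp only [h, if_false, Sum.elim_inr, Prod.mk.injEq, true_and]
      rw [Int.even_iff] at h; omega

theorem exists_theta_mul_eq_add {e e' : ℕ} (he : e ≠ 0) (he' : e' ≠ 0) (a a' : ℤ) {d d' : ℤ}
    (hd : d ≠ 0) (hd' : d' ≠ 0) :
    ∃ F G : ℤ⟦X⟧, theta e a d * theta e' a' d' = F + G ∧
      HasSum (fun x : ℤ × ℤ => thetaTerm e a d x.1 * thetaTerm e' a' d' (2 * x.2 - x.1)) F ∧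
      HasSum (fun x : ℤ × ℤ => thetaTerm e a d x.1 * thetaTerm e' a' d' (2 * x.2 + 1 - x.1)) G := by
  have hsum : ∀ g : ℤ × ℤ → ℤ × ℤ, g.Injective →
      Summable fun x => thetaTerm e a d (g x).1 * thetaTerm e' a' d' (g x).2 := fun g hg => by
    simp only [thetaTerm, monomial_mul_monomial]
    have hf (n : ℕ) := (finite_fiber_add (finite_fiber_square he a hd)
      (finite_fiber_square he' a' hd') n).preimage hg.injOn
    exact summable_monomial (f := (fun x : ℤ × ℤ => e * (a + d * x.1).natAbs ^ 2 +
      e' * (a' + d' * x.2).natAbs ^ 2) ∘ g) _ hf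
  have h0 := (hsum _ (paritySplit.injective.comp Sum.inl_injective)).hasSum
  have h1 := (hsum _ (paritySplit.injective.comp Sum.inr_injective)).hasSum
  refine ⟨_, _, ?_, h0, h1⟩
  have h := hasSum_theta_mul he he' a a' hd hd'
  rw [← paritySplit.hasSum_iff] at h
  exact h.unique (h0.sum h1)

theorem thetaTerm_mul_thetaTerm_eq {e₁ e₂ e₃ e₄ : ℕ} {a₁ a₂ a₃ a₄ d₁ d₂ d₃ d₄ j₁ j₂ j₃ j₄ : ℤ}
    (h : e₁ * (a₁ + d₁ * j₁) ^ 2 + e₂ * (a₂ + d₂ * j₂) ^ 2 =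
      e₃ * (a₃ + d₃ * j₃) ^ 2 + e₄ * (a₄ + d₄ * j₄) ^ 2) (hj : Even (j₁ + j₂ - (j₃ + j₄))) :
    thetaTerm e₁ a₁ d₁ j₁ * thetaTerm e₂ a₂ d₂ j₂ =
      thetaTerm e₃ a₃ d₃ j₃ * thetaTerm e₄ a₄ d₄ j₄ := by
  simp only [thetaTerm, monomial_mul_monomial]
  rw [← Units.val_mul, ← Units.val_mul, ← Int.negOnePow_add, ← Int.negOnePow_add,
    (Int.negOnePow_eq_iff _ _).mpr hj]
  congr 2
  zify
  simpa only [sq_abs] using h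

theorem thetaTerm_mul_thetaTerm_eq_neg {e₁ e₂ e₃ e₄ : ℕ}
    {a₁ a₂ a₃ a₄ d₁ d₂ d₃ d₄ j₁ j₂ j₃ j₄ : ℤ}
    (h : e₁ * (a₁ + d₁ * j₁) ^ 2 + e₂ * (a₂ + d₂ * j₂) ^ 2 =
      e₃ * (a₃ + d₃ * j₃) ^ 2 + e₄ * (a₄ + d₄ * j₄) ^ 2) (hj : Odd (j₁ + j₂ - (j₃ + j₄))) :
    thetaTerm e₁ a₁ d₁ j₁ * thetaTerm e₂ a₂ d₂ j₂ =
      -(thetaTerm e₃ a₃ d₃ j₃ * thetaTerm e₄ a₄ d₄ j₄) := by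
  simp only [thetaTerm, monomial_mul_monomial]
  have hs : (j₁ + j₂).negOnePow = -(j₃ + j₄).negOnePow := by
    rw [← sub_add_cancel (j₁ + j₂) (j₃ + j₄), Int.negOnePow_add, Int.negOnePow_odd _ hj, neg_one_mul]
  rw [← Units.val_mul, ← Units.val_mul, ← Int.negOnePow_add, ← Int.negOnePow_add, hs,
    Units.val_neg, map_neg]
  congr 3
  zify
  simpa only [sq_abs] using h

/-- The quintuple product identity, as an identity between theta series. -/
theorem theta_quintuple {N : ℤ} (hN : N ≠ 0) (s : ℤ) :
    (theta 1 (N + 6 * s) (6 * N) + theta 1 (N - 6 * s) (6 * N)) * theta 3 (N - 2 * s) (2 * N) =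
      theta 1 N (6 * N) * theta 3 (N - 4 * s) (2 * N) := by
  have h2 : 2 * N ≠ 0 := by omega
  have h6 : 6 * N ≠ 0 := by omega
  obtain ⟨F₁, F₂, hF, hF₁, hF₂⟩ := exists_theta_mul_eq_add one_ne_zero three_ne_zero
    (N + 6 * s) (N - 2 * s) h6 h2
  obtain ⟨F₃, F₄, hF', hF₃, hF₄⟩ := exists_theta_mul_eq_add one_ne_zero three_ne_zero
    (N - 6 * s) (N - 2 * s) h6 h2
  obtain ⟨G₀, G₁, hG, hG₀, hG₁⟩ := exists_theta_mul_eq_add one_ne_zero three_ne_zero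
    N (N - 4 * s) h6 h2
  -- In terms of the two bases `u`, `v` of the squares, each `σ` is an isometry of `u^2 + 3v^2` such
  -- as `(u, v) ↦ ((3v - u)/2, (u + v)/2)`; the parity splitting makes the halves land in the right
  -- progressions. `F₁` and `F₄` cancel, and `F₂`, `F₃` give the right side.
  let σ₁ : ℤ × ℤ ≃ ℤ × ℤ :=
    ⟨fun x => (x.2 - x.1, -x.1 - 1), fun y => (-y.2 - 1, y.1 - y.2 - 1),
      fun x => by grind, fun x => by grind⟩
  let σ₂ : ℤ × ℤ ≃ ℤ × ℤ :=
    ⟨fun x => (-x.2 - 1, -x.1 - 1), fun y => (-y.2 - 1, -y.1 - 1),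
      fun x => by grind, fun x => by grind⟩
  let σ₃ : ℤ × ℤ ≃ ℤ × ℤ :=
    ⟨fun x => (x.2 - x.1, x.2), fun y => (y.2 - y.1, y.2),
      fun x => by grind, fun x => by grind⟩
  have e₁ : F₁ = -F₄ := by
    rw [← σ₁.hasSum_iff] at hF₄
    refine hF₁.unique (hF₄.neg.congr_fun fun x => ?_)
    refine thetaTerm_mul_thetaTerm_eq_neg ?_ ⟨x.1 + x.2, ?_⟩
    · simp only [σ₁, Equiv.coe_fn_mk]; push_cast; ring
    · simp only [σ₁, Equiv.coe_fn_mk]; ring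
  have e₂ : F₂ = G₁ := by
    rw [← σ₂.hasSum_iff] at hG₁
    refine hF₂.unique (hG₁.congr_fun fun x => ?_)
    refine thetaTerm_mul_thetaTerm_eq ?_ ⟨x.1 + x.2 + 1, ?_⟩
    · simp only [σ₂, Equiv.coe_fn_mk]; push_cast; ring
    · simp only [σ₂, Equiv.coe_fn_mk]; ring
  have e₃ : F₃ = G₀ := by
    rw [← σ₃.hasSum_iff] at hG₀
    refine hF₃.unique (hG₀.congr_fun fun x => ?_)
    refine thetaTerm_mul_thetaTerm_eq ?_ ⟨0, ?_⟩
    · simp only [σ₃, Equiv.coe_fn_mk]; push_cast; ring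
    · simp only [σ₃, Equiv.coe_fn_mk]; ring
  rw [add_mul, hF, hF', hG, e₁, e₂, e₃]
  ring

/-! ### Nonvanishing, and Euler's product as a theta series -/

/-- Only `j = 0` contributes to the exponent `e * a^2`: another contribution needs `a + d * j = -a`,
hence `d ∣ 2 * a`. -/
theorem theta_ne_zero {e : ℕ} (he : e ≠ 0) {a d : ℤ} (hd : d ≠ 0) (h : ¬ d ∣ 2 * a) :
    theta e a d ≠ 0 := by
  intro h0
  have hs := (WithPiTopology.hasSum_iff_hasSum_coeff ℤ).mp (hasSum_theta he a hd)
    (e * a.natAbs ^ 2)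
  rw [h0, map_zero] at hs
  have hs' : HasSum (fun j => coeff (e * a.natAbs ^ 2) (thetaTerm e a d j)) (1 : ℤ) := by
    convert hasSum_ite_eq (0 : ℤ) (1 : ℤ) using 2 with j
    rw [thetaTerm, coeff_monomial]
    by_cases hj : j = 0
    · simp [hj]
    · rw [if_neg hj, if_neg]
      intro hn
      have h1 := Nat.pow_left_injective two_ne_zero (Nat.eq_of_mul_eq_mul_left
        (Nat.pos_of_ne_zero he) hn)
      rcases Int.natAbs_eq_natAbs_iff.mp h1 with h2 | h2
      · have h3 : d * j = 0 := by linarith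
        exact absurd h3 (mul_ne_zero hd hj)
      · exact h ⟨-j, by linarith⟩
  exact zero_ne_one (hs.unique hs')

theorem continuous_expand {d : ℕ} (hd : d ≠ 0) :
    Continuous (expand d hd : ℤ⟦X⟧ → ℤ⟦X⟧) := by
  refine continuous_iff_continuousAt.mpr fun f => ?_
  rw [ContinuousAt, WithPiTopology.tendsto_iff_coeff_tendsto]
  intro n
  simp only [coeff_expand]
  split_ifs
  · exact (WithPiTopology.continuous_coeff ℤ _).tendsto f
  · exact tendsto_const_nhds

theorem euler_X : euler (X : ℤ⟦X⟧) = pentagonalSeries ℤ :=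
  WithPiTopology.tprod_one_sub_X_pow ℤ

theorem euler_X_pow {d : ℕ} (hd : d ≠ 0) :
    euler ((X : ℤ⟦X⟧) ^ d) = expand d hd (euler X) := by
  rw [euler, euler]
  have h := multipliable_euler one_ne_zero
  simp only [pow_one] at h
  rw [h.map_tprod _ (continuous_expand hd)]
  simp [expand_X]

theorem hasSum_euler_X :
    HasSum (fun k : ℤ => monomial (pentagonal k) (k.negOnePow : ℤ)) (euler (X : ℤ⟦X⟧)) := by
  rw [euler_X]
  refine (WithPiTopology.hasSum_pentagonalSeries ℤ).congr_fun fun k => ?_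
  rw [monomial_eq_C_mul_X_pow]
  simp

theorem X_pow_mul_expand_monomial {d : ℕ} (hd : d ≠ 0) (a n : ℕ) (c : ℤ) :
    X ^ a * expand d hd (monomial n c) = monomial (d * n + a) c := by
  rw [expand_monomial, X_pow_eq, monomial_mul_monomial, one_mul, add_comm]

theorem hasSum_X_pow_mul_expand {ι : Type*} {f : ι → ℕ} {c : ι → ℤ} {F : ℤ⟦X⟧}
    (h : HasSum (fun i => monomial (f i) (c i)) F) {d : ℕ} (hd : d ≠ 0) (a : ℕ) :
    HasSum (fun i => monomial (d * f i + a) (c i)) (X ^ a * expand d hd F) := by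
  refine ((h.map (expand d hd) (continuous_expand hd)).mul_left (X ^ a)).congr_fun fun i => ?_
  exact (X_pow_mul_expand_monomial hd a _ _).symm

theorem pentagonal_square (k : ℤ) : (-1 + 6 * k).natAbs ^ 2 = 24 * pentagonal k + 1 := by
  zify
  rw [sq_abs]
  linarith [two_mul_natCast_pentagonal k]

theorem theta_eq_expand_euler {N : ℕ} (hN : N ≠ 0) :
    theta 1 N (6 * N) =
      X ^ N ^ 2 * expand 24 (by norm_num) (euler ((X : ℤ⟦X⟧) ^ N ^ 2)) := by
  have h2 := pow_ne_zero 2 hN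
  have h := hasSum_X_pow_mul_expand hasSum_euler_X (mul_ne_zero (by norm_num : 24 ≠ 0) h2) (N ^ 2)
  rw [expand_mul, ← euler_X_pow, ← (Equiv.neg ℤ).hasSum_iff] at h
  · refine HasSum.unique ((hasSum_theta one_ne_zero _ (by positivity)).congr_fun fun k => ?_) h
    rw [Function.comp_apply, Equiv.neg_apply, thetaTerm, Int.negOnePow_neg]
    congr 2
    rw [show (N : ℤ) + 6 * N * k = -(N * (-1 + 6 * -k)) by ring, Int.natAbs_neg, Int.natAbs_mul,
      mul_pow, pentagonal_square, Int.natAbs_natCast]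
    ring
  · norm_num
  · exact h2

/-! ### Residue parts of Euler's product -/

/-- The part of a power series with exponents congruent to `p` modulo `N`. -/
noncomputable def residuePart (N p : ℕ) (f : ℤ⟦X⟧) : ℤ⟦X⟧ :=
  PowerSeries.mk fun n => if n % N = p then coeff n f else 0

/-- The second factor has only exponents divisible by `N`, so it preserves residue classes. -/
theorem residuePart_mul_expand {N : ℕ} (hN : N ≠ 0) (p : ℕ) (f g : ℤ⟦X⟧) :
    residuePart N p (f * expand N hN g) = residuePart N p f * expand N hN g := by
  ext n
  simp only [residuePart, coeff_mk, coeff_mul, ite_mul, zero_mul]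
  split_ifs with h
  · refine Finset.sum_congr rfl fun x hx => ?_
    rw [coeff_expand]
    split_ifs with h1 h2
    · rfl
    · rw [← Finset.HasAntidiagonal.mem_antidiagonal.mp hx] at h
      obtain ⟨c, hc⟩ := h1
      simp [hc] at h
      exact absurd h h2
    · simp
    · simp
  · refine (Finset.sum_eq_zero fun x hx => ?_).symm
    rw [coeff_expand]
    split_ifs with h1 h2
    · rw [← Finset.HasAntidiagonal.mem_antidiagonal.mp hx] at h
      obtain ⟨c, hc⟩ := h2
      simp [hc] at h
      exact absurd h1 h
    · simp
    · rfl

theorem residuePart_eulerQuotient {N : ℕ} (hN : N ≠ 0) {p : ℕ} (hp : p < N) :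
    residuePart N p (eulerQuotient N) = X ^ p * expand N hN (J N p) := by
  ext n
  rw [residuePart, coeff_mk, coeff_X_pow_mul', coeff_expand]
  have hn := Nat.div_add_mod n N
  by_cases h : n % N = p
  · have h1 : n - p = N * (n / N) := by omega
    rw [if_pos h, if_pos (by omega), h1, if_pos (dvd_mul_right _ _),
      Nat.mul_div_cancel_left _ (Nat.pos_of_ne_zero hN), J, coeff_mk, ← h, hn]
  · rw [if_neg h]
    split_ifs with h1 h2
    · obtain ⟨c, hc⟩ := h2
      exact absurd (by rw [show n = p + N * c by omega, Nat.add_mul_mod_self_left,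
        Nat.mod_eq_of_lt hp]) h
    · rfl
    · rfl

theorem residuePart_euler {N : ℕ} (hN : N ≠ 0) {p : ℕ} (hp : p < N) :
    residuePart N p (euler X) = X ^ p * expand N hN (J N p) * euler (X ^ N ^ 2) := by
  have h : euler ((X : ℤ⟦X⟧) ^ N ^ 2) = expand N hN (euler (X ^ N)) := by
    rw [euler_X_pow (pow_ne_zero 2 hN), euler_X_pow hN, ← expand_mul]
    simp only [sq]
  rw [← residuePart_eulerQuotient hN hp, ← euler_mul_eulerQuotient hN, mul_comm, h,
    residuePart_mul_expand]

theorem hasSum_residuePart_euler (N p : ℕ) :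
    HasSum (fun k => monomial (pentagonal k)
      (if pentagonal k % N = p then (k.negOnePow : ℤ) else 0)) (residuePart N p (euler X)) := by
  rw [WithPiTopology.hasSum_iff_hasSum_coeff]
  intro n
  have h := (WithPiTopology.hasSum_iff_hasSum_coeff ℤ).mp hasSum_euler_X n
  rw [residuePart, coeff_mk]
  split_ifs with hn
  · refine h.congr_fun fun k => ?_
    rw [coeff_monomial, coeff_monomial]
    split_ifs <;> simp_all
  · refine hasSum_zero.congr_fun fun k => ?_
    rw [coeff_monomial]
    split_ifs <;> simp_all

/-- The normalization `X * P(X ^ 24)` of the part `P` of `(X)_∞` with exponents `p` modulo `N`. -/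
noncomputable def etaPart (N p : ℕ) : ℤ⟦X⟧ :=
  X * expand 24 (by norm_num) (residuePart N p (euler X))

theorem hasSum_etaPart (N p : ℕ) :
    HasSum (fun k => if pentagonal k % N = p then thetaTerm 1 (-1) 6 k else 0) (etaPart N p) := by
  have h := hasSum_X_pow_mul_expand (hasSum_residuePart_euler N p) (by norm_num : 24 ≠ 0) 1
  rw [pow_one] at h
  refine h.congr_fun fun k => ?_
  rw [thetaTerm, one_mul, pentagonal_square]
  split_ifs <;> simp

theorem hasSum_thetaTerm_residue {N : ℕ} (hN : Odd N) (c : ℤ) :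
    HasSum (fun k => if (N : ℤ) ∣ k - c then thetaTerm 1 (-1) 6 k else 0)
      ((c.negOnePow : ℤ) • theta 1 (6 * c - 1) (6 * N)) := by
  have hN0 : (N : ℤ) ≠ 0 := by have := hN.pos; omega
  have hinj : Function.Injective fun j : ℤ => c + N * j := fun x y h => by
    simpa using mul_left_cancel₀ hN0 (add_left_cancel h)
  rw [← hinj.hasSum_iff]
  · refine ((hasSum_theta one_ne_zero (6 * c - 1) (by simpa using hN0)).const_smul _).congr_fun
      fun j => ?_
    simp only [Function.comp_apply, add_sub_cancel_left, dvd_mul_right, if_true, thetaTerm]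
    rw [← map_smul, Int.negOnePow_add, smul_eq_mul, Units.val_mul,
      show -1 + 6 * (c + N * j) = 6 * c - 1 + 6 * N * j by ring]
    congr 3
    -- `N` is odd, so `N * j` and `j` have the same parity.
    rw [Int.negOnePow_eq_iff]
    obtain ⟨t, rfl⟩ := hN
    exact ⟨t * j, by push_cast; ring⟩
  · intro k hk
    refine if_neg fun ⟨j, hj⟩ => hk ⟨j, ?_⟩
    simp only [← hj]; ring

/-- Modulo `N`, `m` is the centre of symmetry of the quadratic `pentagonal`; its difference of
values factors, and 2 and 3 are invertible. -/
theorem pentagonal_mod_eq_iff {N : ℕ} (hN : N.Prime) (hN3 : 3 < N) {m : ℤ}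
    (hm : (N : ℤ) ∣ 6 * m - 1) (r k : ℤ) :
    pentagonal k % N = pentagonal (m + r) % N ↔
      (N : ℤ) ∣ k - (m + r) ∨ (N : ℤ) ∣ k - (m - r) := by
  have hp := Nat.prime_iff_prime_int.mp hN
  have h2 : ¬ (N : ℤ) ∣ 2 := fun h => by have := Int.le_of_dvd (by norm_num) h; omega
  have h3 : ¬ (N : ℤ) ∣ 3 := fun h => by have := Int.le_of_dvd (by norm_num) h; omega
  have key : 2 * ((pentagonal k : ℤ) - pentagonal (m + r)) =
      (k - (m + r)) * (3 * (k - (m - r)) + (6 * m - 1)) := by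
    linear_combination two_mul_natCast_pentagonal k - two_mul_natCast_pentagonal (m + r)
  have h4 : (N : ℤ) ∣ 3 * (k - (m - r)) + (6 * m - 1) ↔ (N : ℤ) ∣ k - (m - r) := by
    rw [Int.dvd_add_left hm, hp.dvd_mul]
    simp [h3]
  rw [eq_comm, ← Nat.ModEq, Nat.modEq_iff_dvd, ← h4, ← hp.dvd_mul, ← key, hp.dvd_mul]
  simp [h2]

theorem etaPart_pentagonal {N : ℕ} (hN : N.Prime) (hN3 : 3 < N) {m : ℤ}
    (hm : (N : ℤ) = |6 * m - 1|) {r : ℤ} (hr : ¬ (N : ℤ) ∣ r) :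
    etaPart N (pentagonal (m + r) % N) = ((m + r).negOnePow : ℤ) •
      (theta 1 (N + 6 * r) (6 * N) + theta 1 (N - 6 * r) (6 * N)) := by
  have hodd : Odd N := hN.odd_of_ne_two (by omega)
  have hdvd : (N : ℤ) ∣ 6 * m - 1 := by rw [hm, abs_dvd]
  have hd : 6 * (N : ℤ) ≠ 0 := by omega
  have h2 : ¬ (N : ℤ) ∣ 2 := fun h => by have := Int.le_of_dvd (by norm_num) h; omega
  have h1 := (hasSum_thetaTerm_residue hodd (m + r)).add (hasSum_thetaTerm_residue hodd (m - r))
  have hsign : (m - r).negOnePow = (m + r).negOnePow :=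
    (Int.negOnePow_eq_iff _ _).mpr ⟨-r, by ring⟩
  rw [hsign, ← smul_add] at h1
  have h3 : theta 1 (6 * (m + r) - 1) (6 * N) + theta 1 (6 * (m - r) - 1) (6 * N) =
      theta 1 (N + 6 * r) (6 * N) + theta 1 (N - 6 * r) (6 * N) := by
    -- If `6m - 1 = -N`, the symmetry of `theta` in its offset swaps the two series.
    rcases abs_choice (6 * m - 1) with h | h
    · rw [show 6 * (m + r) - 1 = N + 6 * r by rw [hm, h]; ring,
        show 6 * (m - r) - 1 = N - 6 * r by rw [hm, h]; ring]
    · rw [show 6 * (m + r) - 1 = -(N - 6 * r) by rw [hm, h]; ring,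
        show 6 * (m - r) - 1 = -(N + 6 * r) by rw [hm, h]; ring,
        theta_neg one_ne_zero _ hd, theta_neg one_ne_zero _ hd, add_comm]
  rw [← h3]
  refine (hasSum_etaPart N _).unique (h1.congr_fun fun k => ?_)
  simp only [pentagonal_mod_eq_iff hN hN3 hdvd r k]
  by_cases ha : (N : ℤ) ∣ k - (m + r) <;> by_cases hb : (N : ℤ) ∣ k - (m - r)
  · have h := dvd_sub hb ha
    rw [show k - (m - r) - (k - (m + r)) = 2 * r by ring,
      (Nat.prime_iff_prime_int.mp hN).dvd_mul] at h
    tauto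
  all_goals simp [ha, hb]

theorem etaPart_pentagonal_zero {N : ℕ} (hN : N.Prime) (hN3 : 3 < N) {m : ℤ}
    (hm : (N : ℤ) = |6 * m - 1|) :
    etaPart N (pentagonal m % N) = (m.negOnePow : ℤ) • theta 1 N (6 * N) := by
  have hodd : Odd N := hN.odd_of_ne_two (by omega)
  have hdvd : (N : ℤ) ∣ 6 * m - 1 := by rw [hm, abs_dvd]
  have hd : 6 * (N : ℤ) ≠ 0 := by omega
  have h3 : theta 1 (6 * m - 1) (6 * N) = theta 1 N (6 * N) := by
    rcases abs_choice (6 * m - 1) with h | h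
    · rw [← h, ← hm]
    · rw [← theta_neg one_ne_zero _ hd, ← h, ← hm]
  rw [← h3]
  refine (hasSum_etaPart N _).unique ((hasSum_thetaTerm_residue hodd m).congr_fun fun k => ?_)
  have h := pentagonal_mod_eq_iff hN hN3 hdvd 0 k
  simp only [add_zero, sub_zero, or_self] at h
  simp only [h]

/-! ### The telescoping product and its sign -/

/-- The doubling map on `{1, …, h}`, a set of representatives of the nonzero residues modulo
`2 * h + 1` up to sign. -/
theorem prod_double {M : Type*} [CommMonoid M] (h : ℕ) (f : ℕ → M)
    (hf : ∀ s ≤ 2 * h + 1, f (2 * h + 1 - s) = f s) :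
    ∏ s ∈ Finset.Icc 1 h, f (2 * s) = ∏ s ∈ Finset.Icc 1 h, f s := by
  refine Finset.prod_bij' (fun s _ => if 2 * s ≤ h then 2 * s else 2 * h + 1 - 2 * s)
    (fun s _ => if s % 2 = 0 then s / 2 else (2 * h + 1 - s) / 2) ?_ ?_ ?_ ?_ ?_
  · intro s hs
    rw [Finset.mem_Icc] at *
    split_ifs <;> omega
  · intro s hs
    rw [Finset.mem_Icc] at *
    split_ifs <;> omega
  · intro s hs
    rw [Finset.mem_Icc] at hs
    split_ifs <;> omega
  · intro s hs
    rw [Finset.mem_Icc] at hs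
    split_ifs <;> omega
  · intro s hs
    rw [Finset.mem_Icc] at hs
    split_ifs
    · rfl
    · exact (hf _ (by omega)).symm

theorem theta_three_ne_zero {N : ℕ} (hN : N.Prime) (hN2 : 2 < N) {s : ℤ} (hs : ¬ (N : ℤ) ∣ s) :
    theta 3 (N - 2 * s) (2 * N) ≠ 0 := by
  refine theta_ne_zero three_ne_zero (by omega) fun ⟨c, hc⟩ => ?_
  have h : (N : ℤ) ∣ 2 * s := ⟨1 - c, by linarith⟩
  rcases (Nat.prime_iff_prime_int.mp hN).dvd_or_dvd h with h2 | h2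
  · have := Int.le_of_dvd (by norm_num) h2
    omega
  · exact hs h2

theorem theta_one_ne_zero {N : ℕ} (hN : N ≠ 0) : theta 1 N (6 * N) ≠ 0 := by
  refine theta_ne_zero one_ne_zero (by positivity) fun h => ?_
  have := Int.le_of_dvd (by positivity) h
  omega

theorem not_dvd_of_mem_Icc {h N s : ℕ} (hN : N = 2 * h + 1) (hs : s ∈ Finset.Icc 1 h) :
    ¬ (N : ℤ) ∣ s := by
  rw [Finset.mem_Icc] at hs
  exact fun hd => by have := Nat.le_of_dvd (by omega) (Int.natCast_dvd_natCast.mp hd); omega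

theorem etaPart_mul_theta {N : ℕ} (hN : N.Prime) (hN3 : 3 < N) {m : ℤ}
    (hm : (N : ℤ) = |6 * m - 1|) {s : ℤ} (hs : ¬ (N : ℤ) ∣ s) :
    etaPart N (pentagonal (m + s) % N) * theta 3 (N - 2 * s) (2 * N) =
      ((m + s).negOnePow : ℤ) • (theta 1 N (6 * N) * theta 3 (N - 2 * (2 * s)) (2 * N)) := by
  rw [etaPart_pentagonal hN hN3 hm hs, smul_mul_assoc, theta_quintuple (by omega),
    ← mul_assoc 2 2 s]
  norm_num

theorem prod_etaPart {N : ℕ} (hN : N.Prime) (hN3 : 3 < N) {m : ℤ}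
    (hm : (N : ℤ) = |6 * m - 1|) {h : ℕ} (hh : N = 2 * h + 1) :
    ∏ s ∈ Finset.range (h + 1), etaPart N (pentagonal (m + s) % N) =
      (∏ s ∈ Finset.range (h + 1), ((m + s).negOnePow : ℤ)) • theta 1 N (6 * N) ^ (h + 1) := by
  have hI : Finset.Icc 1 h = (Finset.range h).image (· + 1) := by
    ext x; simp only [Finset.mem_Icc, Finset.mem_image, Finset.mem_range]
    exact ⟨fun hx => ⟨x - 1, by omega, by omega⟩, by rintro ⟨y, hy, rfl⟩; omega⟩
  have hprod {M : Type} [CommMonoid M] (f : ℕ → M) :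
      ∏ s ∈ Finset.range (h + 1), f s = (∏ s ∈ Finset.Icc 1 h, f s) * f 0 := by
    rw [Finset.prod_range_succ', hI, Finset.prod_image (by simp)]
  have h1 : (∏ s ∈ Finset.Icc 1 h, etaPart N (pentagonal (m + s) % N)) *
      ∏ s ∈ Finset.Icc 1 h, theta 3 (N - 2 * (s : ℤ)) (2 * N) =
      (∏ s ∈ Finset.Icc 1 h, ((m + s).negOnePow : ℤ)) • (theta 1 N (6 * N) ^ h *
        ∏ s ∈ Finset.Icc 1 h, theta 3 (N - 2 * (s : ℤ)) (2 * N)) := by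
    have hT := prod_double h (fun s : ℕ => theta 3 (N - 2 * (s : ℤ)) (2 * N)) fun s hs => by
      rw [← theta_neg three_ne_zero _ (by omega : 2 * (N : ℤ) ≠ 0)]
      congr 1
      omega
    rw [← Finset.prod_mul_distrib, Finset.prod_congr rfl fun s hs =>
      etaPart_mul_theta hN hN3 hm (not_dvd_of_mem_Icc hh hs), Finset.prod_smul,
      Finset.prod_mul_distrib, Finset.prod_const, Nat.card_Icc, Nat.add_sub_cancel, ← hT]
    push_cast
    rfl
  -- Needed to cancel the common factor of the two sides of `h1`.
  have h2 : ∏ s ∈ Finset.Icc 1 h, theta 3 (N - 2 * (s : ℤ)) (2 * N) ≠ 0 :=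
    Finset.prod_ne_zero_iff.mpr fun s hs =>
      theta_three_ne_zero hN (by omega) (not_dvd_of_mem_Icc hh hs)
  rw [← smul_mul_assoc] at h1
  rw [hprod, hprod, mul_right_cancel₀ h2 h1, Nat.cast_zero, add_zero,
    etaPart_pentagonal_zero hN hN3 hm, smul_mul_smul_comm, pow_succ]

theorem prod_negOnePow {N : ℕ} {m : ℤ} (hm : (N : ℤ) = |6 * m - 1|) {h : ℕ} (hh : N = 2 * h + 1) :
    ∏ s ∈ Finset.range (h + 1), ((m + s).negOnePow : ℤ) =
      (-1) ^ (m.natAbs * (m.natAbs - 1) / 2) := by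
  have h1 (n : ℕ) : ∏ s ∈ Finset.range n, ((m + s).negOnePow : ℤ) =
      ((n * m + (n * (n - 1) / 2 : ℕ)).negOnePow : ℤ) := by
    induction n with
    | zero => simp
    | succ n ih =>
      rw [Finset.prod_range_succ, ih, ← Units.val_mul, ← Int.negOnePow_add,
        ← Finset.sum_range_id, ← Finset.sum_range_id, Finset.sum_range_succ]
      congr 2
      push_cast
      ring
  have h2 (n : ℕ) : ((-1 : ℤ)) ^ n = ((n : ℤ).negOnePow : ℤ) := by
    rw [Int.negOnePow_def]; simp
  rw [h1, h2, (Int.negOnePow_eq_iff _ _).mpr]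
  have h3 (n : ℕ) : 2 * ((n * (n - 1) / 2 : ℕ) : ℤ) = n * (n - 1) := by
    have h4 := Nat.mul_div_cancel' (Nat.even_mul_pred_self n).two_dvd
    rcases n with _ | n
    · simp
    · rw [← Nat.cast_two, ← Nat.cast_mul, h4]; push_cast; simp
  have h5 := h3 (h + 1)
  have h6 := h3 m.natAbs
  generalize ((m.natAbs * (m.natAbs - 1) / 2 : ℕ) : ℤ) = u at *
  generalize (((h + 1) * (h + 1 - 1) / 2 : ℕ) : ℤ) = v at *
  push_cast at h5
  -- With `m(m - 1) = 2w`, the two sign exponents differ by `2w` if `m ≤ 0` (where `h = -3m`) and by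
  -- `2w + 6m^2` if `m > 0` (where `h = 3m - 1`).
  obtain ⟨w, hw⟩ := Int.even_mul_pred_self m
  rcases le_or_gt m 0 with h7 | h7
  · have h8 : (h : ℤ) = -3 * m := by rw [abs_of_neg (by omega)] at hm; omega
    have h9 : (m.natAbs : ℤ) = -m := by omega
    rw [h8] at h5
    rw [h9] at h6
    refine ⟨w, ?_⟩
    push_cast [h8]
    linarith
  · have h8 : (h : ℤ) = 3 * m - 1 := by rw [abs_of_pos (by omega)] at hm; omega
    have h9 : (m.natAbs : ℤ) = m := by omega
    rw [h8] at h5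
    rw [h9] at h6
    refine ⟨w + 3 * m ^ 2, ?_⟩
    push_cast [h8]
    linarith

/-! ### Index set and product of the `J_p` -/

/-- The coefficient of `X ^ b` is nonzero, which forces `a ≤ b` and `e ∣ b - a`. This is where `Z`
is seen to be a non-negative integer. -/
theorem X_pow_mul_expand_eq {e : ℕ} (he : e ≠ 0) {a b : ℕ} {P : ℤ⟦X⟧} {c : ℤ} (hc : c ≠ 0)
    (h : X ^ a * expand e he P = c • X ^ b) : ∃ Z : ℕ, b = a + e * Z ∧ P = c • X ^ Z := by
  have h1 := congrArg (coeff b) h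
  rw [coeff_X_pow_mul', coeff_expand, map_zsmul, coeff_X_pow_self] at h1
  have hab : a ≤ b := by
    by_contra hab
    simp [hab, hc.symm] at h1
  rw [if_pos hab] at h1
  have hdvd : e ∣ b - a := by
    by_contra hdvd
    simp [hdvd, hc.symm] at h1
  obtain ⟨Z, hZ⟩ := hdvd
  have hb : b = a + e * Z := by omega
  refine ⟨Z, hb, ?_⟩
  have h2 : expand e he P = expand e he (c • X ^ Z) := by
    refine mul_left_cancel₀ (pow_ne_zero a X_ne_zero) ?_
    rw [h, map_smul, map_pow, expand_X, hb, pow_add, pow_mul, mul_smul_comm]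
  ext n
  rw [← coeff_expand_mul e he, h2, coeff_expand_mul]

theorem euler_X_pow_ne_zero {d : ℕ} (hd : d ≠ 0) : euler ((X : ℤ⟦X⟧) ^ d) ≠ 0 := fun h => by
  simpa [h] using constantCoeff_euler hd

theorem residuePart_euler_eq_zero_iff {N : ℕ} (hN : N ≠ 0) {p : ℕ} (hp : p < N) :
    residuePart N p (euler X) = 0 ↔ J N p = 0 := by
  rw [residuePart_euler hN hp]
  constructor
  · intro h
    have h1 := (mul_eq_zero.mp ((mul_eq_zero.mp h).resolve_right
      (euler_X_pow_ne_zero (pow_ne_zero 2 hN)))).resolve_left (pow_ne_zero p X_ne_zero)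
    ext n
    rw [← coeff_expand_mul N hN, h1, map_zero, map_zero]
  · intro h
    rw [h, map_zero, mul_zero, zero_mul]

theorem pentagonal_mod_injOn {N : ℕ} (hN : N.Prime) (hN3 : 3 < N) {m : ℤ}
    (hm : (N : ℤ) = |6 * m - 1|) {h : ℕ} (hh : N = 2 * h + 1) :
    Set.InjOn (fun s : ℕ => pentagonal (m + s) % N) (Finset.range (h + 1)) := by
  intro s hs t ht hst
  rw [Finset.mem_coe, Finset.mem_range] at hs ht
  have hdvd : (N : ℤ) ∣ 6 * m - 1 := by rw [hm, abs_dvd]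
  rcases (pentagonal_mod_eq_iff hN hN3 hdvd t (m + s)).mp hst with h1 | h1
  · have := Int.eq_zero_of_abs_lt_dvd h1 (by rw [abs_lt]; omega)
    omega
  · have := Int.eq_zero_of_abs_lt_dvd h1 (by rw [abs_lt]; omega)
    omega

theorem nonzeroIndices_eq {N : ℕ} (hN : N.Prime) (hN3 : 3 < N) {m : ℤ}
    (hm : (N : ℤ) = |6 * m - 1|) {h : ℕ} (hh : N = 2 * h + 1) :
    nonzeroIndices N = (Finset.range (h + 1)).image fun s : ℕ => pentagonal (m + s) % N := by
  have hN0 := hN.ne_zero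
  have hdvd : (N : ℤ) ∣ 6 * m - 1 := by rw [hm, abs_dvd]
  ext p
  simp only [nonzeroIndices, Finset.mem_filter, Finset.mem_range, Finset.mem_image]
  constructor
  · rintro ⟨hp, hJ⟩
    obtain ⟨k, rfl⟩ : ∃ k, pentagonal k % N = p := by
      by_contra! hk
      refine hJ ((residuePart_euler_eq_zero_iff hN0 hp).mp ((hasSum_residuePart_euler N p).unique
        (hasSum_zero.congr_fun fun k => ?_)))
      rw [if_neg (hk k), map_zero]
    have h1 := Int.emod_nonneg (k - m) (Int.natCast_ne_zero.mpr hN0)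
    have h2 := Int.emod_lt_of_pos (k - m) (Int.natCast_pos.mpr hN.pos)
    have h3 : (N : ℤ) ∣ k - m - (k - m) % N := Int.dvd_self_sub_emod
    generalize (k - m) % N = t at *
    -- The residue `t` of `k - m` is replaced by `N - t` when it exceeds `h`, using the symmetry
    -- about `m`.
    by_cases ht : t ≤ h
    · refine ⟨t.toNat, by omega, ((pentagonal_mod_eq_iff hN hN3 hdvd _ k).mpr (.inl ?_)).symm⟩
      rwa [Int.toNat_of_nonneg h1, ← sub_sub]
    · refine ⟨(N - t).toNat, by omega,
        ((pentagonal_mod_eq_iff hN hN3 hdvd _ k).mpr (.inr ?_)).symm⟩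
      rw [Int.toNat_of_nonneg (by omega), show k - (m - (N - t)) = k - m - t + N by ring]
      exact dvd_add_self_right.mpr h3
  · rintro ⟨s, hs, rfl⟩
    have hlt := Nat.mod_lt (pentagonal (m + s)) hN.pos
    refine ⟨hlt, fun hJ => ?_⟩
    -- A vanishing factor would kill the product in `prod_etaPart`, which is a sign times a power of
    -- a nonzero theta series.
    have h1 : etaPart N (pentagonal (m + s) % N) = 0 := by
      rw [etaPart, (residuePart_euler_eq_zero_iff hN0 hlt).mpr hJ, map_zero, mul_zero]
    have h2 := prod_etaPart hN hN3 hm hh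
    rw [Finset.prod_eq_zero (Finset.mem_range.mpr hs) h1, prod_negOnePow hm hh, zsmul_eq_mul] at h2
    push_cast at h2
    exact mul_ne_zero (pow_ne_zero _ (neg_ne_zero.mpr one_ne_zero))
      (pow_ne_zero _ (theta_one_ne_zero hN0)) h2.symm

theorem etaPart_eq {N : ℕ} (hN : N ≠ 0) {p : ℕ} (hp : p < N) :
    etaPart N p = X * (X ^ (24 * p) * expand (24 * N) (mul_ne_zero (by norm_num) hN) (J N p) *
      expand 24 (by norm_num) (euler (X ^ N ^ 2))) := by
  rw [etaPart, residuePart_euler hN hp, map_mul, map_mul, map_pow, expand_X, ← pow_mul,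
    expand_mul 24 (by norm_num) N hN]

theorem prod_J_expand {N : ℕ} (hN : N.Prime) (hN3 : 3 < N) {m : ℤ}
    (hm : (N : ℤ) = |6 * m - 1|) {h D : ℕ} (hh : N = 2 * h + 1) (hD : N ^ 2 = 24 * D + 1) :
    X ^ (24 * ∑ p ∈ nonzeroIndices N, p) *
        expand (24 * N) (mul_ne_zero (by norm_num) hN.ne_zero) (∏ p ∈ nonzeroIndices N, J N p) =
      ((-1 : ℤ) ^ (m.natAbs * (m.natAbs - 1) / 2)) • X ^ (24 * (D * (h + 1))) := by
  have hN0 := hN.ne_zero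
  have hinj := pentagonal_mod_injOn hN hN3 hm hh
  have hS := nonzeroIndices_eq hN hN3 hm hh
  have hlt : ∀ p ∈ nonzeroIndices N, p < N := fun p hp => by
    simp only [nonzeroIndices, Finset.mem_filter, Finset.mem_range] at hp
    exact hp.1
  have h1 := prod_etaPart hN hN3 hm hh
  rw [prod_negOnePow hm hh, ← Finset.prod_image (f := etaPart N) hinj, ← hS,
    theta_eq_expand_euler hN0, Finset.prod_congr rfl fun p hp => etaPart_eq hN0 (hlt p hp)] at h1
  have hcard : (nonzeroIndices N).card = h + 1 := by
    rw [hS, Finset.card_image_of_injOn hinj, Finset.card_range]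
  simp only [Finset.prod_mul_distrib, Finset.prod_const, hcard, Finset.prod_pow_eq_pow_sum,
    ← map_prod] at h1
  set E := expand 24 (by norm_num) (euler ((X : ℤ⟦X⟧) ^ N ^ 2)) with hE
  have hE0 : E ≠ 0 := fun hz => by
    have h2 := congrArg constantCoeff hz
    rw [hE, constantCoeff_expand, constantCoeff_euler (pow_ne_zero 2 hN0), map_zero] at h2
    exact one_ne_zero h2
  refine mul_left_cancel₀ (pow_ne_zero (h + 1) X_ne_zero)
    (mul_right_cancel₀ (pow_ne_zero (h + 1) hE0) ?_)
  rw [mul_assoc, Finset.mul_sum, h1, mul_pow, ← pow_mul, hD, mul_smul_comm, smul_mul_assoc,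
    ← pow_add]
  congr 3
  ring

end RamanujanJ

theorem theorem2 (N : ℕ) (hN : N.Prime) (hN3 : 3 < N) (m : ℤ) (hm : (N : ℤ) = |6 * m - 1|) :
    (RamanujanJ.nonzeroIndices N).card = (N + 1) / 2 ∧
    ∃ Z : ℕ,
      (Z : ℚ) = ((N : ℚ) - 1) * ((N : ℚ) + 1) ^ 2 / (48 * (N : ℚ)) -
        ∑ p ∈ RamanujanJ.nonzeroIndices N, (p : ℚ) / (N : ℚ) ∧
      ∏ p ∈ RamanujanJ.nonzeroIndices N, RamanujanJ.J N p =
        (-1) ^ (m.natAbs * (m.natAbs - 1) / 2) * PowerSeries.X ^ Z := by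
  obtain ⟨h, hh⟩ := hN.odd_of_ne_two (by omega)
  obtain ⟨D, hD⟩ : ∃ D, N ^ 2 = 24 * D + 1 := by
    refine ⟨pentagonal m, ?_⟩
    rw [← RamanujanJ.pentagonal_square]
    zify
    rw [hm, neg_add_eq_sub]
  refine ⟨?_, ?_⟩
  · rw [RamanujanJ.nonzeroIndices_eq hN hN3 hm hh,
      Finset.card_image_of_injOn (RamanujanJ.pentagonal_mod_injOn hN hN3 hm hh), Finset.card_range]
    omega
  obtain ⟨Z, hZ, hP⟩ := RamanujanJ.X_pow_mul_expand_eq _ (pow_ne_zero _ (by norm_num))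
    (RamanujanJ.prod_J_expand hN hN3 hm hh hD)
  refine ⟨Z, ?_, ?_⟩
  · have hN0 : (N : ℚ) ≠ 0 := Nat.cast_ne_zero.mpr hN.ne_zero
    have hZ' : (24 : ℚ) * (D * (h + 1)) =
        24 * ∑ p ∈ RamanujanJ.nonzeroIndices N, (p : ℚ) + 24 * N * Z := by
      simpa using congrArg (Nat.cast : ℕ → ℚ) hZ
    have hD' : (N : ℚ) ^ 2 = 24 * D + 1 := by exact_mod_cast hD
    have hh' : (N : ℚ) = 2 * h + 1 := by exact_mod_cast hh
    rw [← Finset.sum_div]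
    field_simp
    linear_combination (-2) * hZ' - (h + 1) * 2 * hD' - (N ^ 2 - 1 : ℚ) * hh'
  · rw [hP, zsmul_eq_mul]
    push_cast
    rfl
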